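/- **Theorem.** Consider the 2-cycles formation: four agents $x_1,\dots,x_4\in\mathbb R^2$, with $$z_1=x_2-x_1,\quad z_2=x_3-x_2,\quad z_3=x_1-x_3,\quad z_4=x_3-x_4,\quad z_5=x_4-x_1 ,$$ and observations $$h_1(x)=(\|z_1\|,\|z_5\|,z_1^Tz_5),\quad h_2(x)=\|z_2\|,\quad h_3(x)=\|z_3\|,\quad h_4(x)=\|z_4\| .$$ A target configuration is given by $\mu=(\bar x_2,\bar x_3,\bar x_4)\in(\mathbb R^2)^3$ (with $\bar x_1=0$), and $E^4$, the space of configurations of four points in the plane modulo rotations and translations, is the set of such $\mu$ modulo rotations; its measure is the one induced by Lebesgue measure on $\mathbb R^6\ni\mu$. Let $d_1,\dots,d_5$ be the lengths of $z_1,\dots,z_5$ for the framework $(0,\bar x_2,\bar x_3,\bar x_4)$ and put $$\delta_1(\mu)=(d_1,d_5),\quad \delta_2(\mu)=d_2,\quad \delta_3(\mu)=d_3,\quad \delta_4(\mu)=d_4 .$$ Let $\mathcal F$ be the space of control systems $$\dot x_1=u_{11}(\delta_1(\mu);h_1(x))\,z_1+u_{12}(\delta_1(\mu);h_1(x))\,z_5,\qquad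 \dot x_i=u_i(\delta_i(\mu);h_i(x))\,z_i\quad(i=2,3,4),$$ where $u_{11},u_{12}:\mathbb R^2\times\mathbb R^3\to\mathbb R$ and $u_2,u_3,u_4:\mathbb R\times\mathbb R\to\mathbb R$ are arbitrary smooth functions, equipped with the $C^r$ topology ($r\in\{0,1,2,\dots,\infty\}$; uniform convergence on compact sets of the derivatives of the $u$'s of order at most $r$). For a given target $\mu$, the vector field is invariant under rotations and translations and so induces a system on configurations modulo rotations and translations. A configuration is called a stable equilibrium if it is an equilibrium of the induced system at which all eigenvalues of the linearization of the induced system have negative real part. A system $u\in\mathcal F$ *locally stabilizes* the framework $\mu$ if, for the target $\mu$, the framework $(0,\bar x_2,\bar x_3,\bar x_4)$ is a stable equilibrium. Then, for every $r$: 1. There is no $u\in\mathcal F$ having a neighborhood in $\mathcal F$ all of whose elements locally stabilize all frameworks in $E^4$. 2. More generally, allowing the equilibrium to move under perturbations, there is no $u\in\mathcal F$ such that, for every $\mu$, $u$ locally stabilizes the framework $\mu$ and, for every neighborhood $W$ of the framework $(0,\bar x_2,\bar x_3,\bar x_4)$ in $(\mathbb R^2)^4$, all $u'$ in some neighborhood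 of $u$ in $\mathcal F$ have, for the target $\mu$, a stable equilibrium in $W$. 3. In fact, for every $u\in\mathcal F$ there is a measurable set of positive measure in $E^4$ (that is, a measurable rotation-invariant set of $\mu\in\mathbb R^6$ of positive Lebesgue measure) none of whose frameworks is locally stabilized by $u$. -/

import Mathlib

open scoped ContDiff Topology

noncomputable section

namespace TwoCycles

/-- The Euclidean plane. -/
abbrev Plane : Type := EuclideanSpace ℝ (Fin 2)

/-- Positions `x₁, x₂, x₃, x₄` of the four agents (indexed by `0, 1, 2, 3`). -/
abbrev Config : Type := Fin 4 → Plane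

/-- A target configuration `μ = [x̄₂, x̄₃, x̄₄]`, with `x̄₁` placed at the origin. Two such vectors
give the same element of `E⁴` exactly when they differ by a rotation of the plane. -/
abbrev Target : Type := Fin 3 → Plane

/-- The framework `(0, x̄₂, x̄₃, x̄₄)` parametrized by `μ`. -/
def framework (μ : Target) : Config := ![0, μ 0, μ 1, μ 2]

/-- Rotation of the plane by the angle `θ`. -/
def rotate (θ : ℝ) (p : Plane) : Plane :=
  !₂[Real.cos θ * p 0 - Real.sin θ * p 1, Real.sin θ * p 0 + Real.cos θ * p 1]

/-- The edge vectors of the 2-cycles formation. -/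
def z₁ (x : Config) : Plane := x 1 - x 0

def z₂ (x : Config) : Plane := x 2 - x 1

def z₃ (x : Config) : Plane := x 0 - x 2

def z₄ (x : Config) : Plane := x 2 - x 3

def z₅ (x : Config) : Plane := x 3 - x 0

/-- The observations of the agents: agent 1 observes the relative positions of its two neighbours
up to rotation, the other agents observe the distance to their only neighbour. -/
def h₁ (x : Config) : ℝ × ℝ × ℝ := (‖z₁ x‖, ‖z₅ x‖, inner ℝ (z₁ x) (z₅ x))

def h₂ (x : Config) : ℝ := ‖z₂ x‖

def h₃ (x : Config) : ℝ := ‖z₃ x‖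

def h₄ (x : Config) : ℝ := ‖z₄ x‖

/-- What the agents know about the target (range only): `δ₁ = (d₁, d₅)`, `δ₂ = d₂`, `δ₃ = d₃`,
`δ₄ = d₄`, where `d₁, …, d₅` are the edge lengths of the target framework. -/
def δ₁ (μ : Target) : ℝ × ℝ := (‖z₁ (framework μ)‖, ‖z₅ (framework μ)‖)

def δ₂ (μ : Target) : ℝ := ‖z₂ (framework μ)‖

def δ₃ (μ : Target) : ℝ := ‖z₃ (framework μ)‖

def δ₄ (μ : Target) : ℝ := ‖z₄ (framework μ)‖

/-- Smooth real-valued functions on `E`. -/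
def SmoothFn (E : Type) [NormedAddCommGroup E] [NormedSpace ℝ E] : Type :=
  {u : E → ℝ // ContDiff ℝ ∞ u}

/-- The `C^r` topology on smooth functions: uniform convergence on compact sets of all derivatives
of order at most `r` (for `r = ∞`: of all derivatives). -/
@[reducible] def SmoothFn.crTopology (E : Type) [NormedAddCommGroup E] [NormedSpace ℝ E] (r : ℕ∞) :
    TopologicalSpace (SmoothFn E) :=
  ⨅ k : {k : ℕ // (k : ℕ∞) ≤ r},
    TopologicalSpace.induced
      (fun u : SmoothFn E => UniformOnFun.ofFun {K : Set E | IsCompact K} (iteratedFDeriv ℝ k u.1))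
      inferInstance

/-- The class `𝓕`: a control system is given by smooth feedbacks `uᵢ(δᵢ; hᵢ)`. -/
structure ControlSystem : Type where
  u₁₁ : SmoothFn ((ℝ × ℝ) × (ℝ × ℝ × ℝ))
  u₁₂ : SmoothFn ((ℝ × ℝ) × (ℝ × ℝ × ℝ))
  u₂ : SmoothFn (ℝ × ℝ)
  u₃ : SmoothFn (ℝ × ℝ)
  u₄ : SmoothFn (ℝ × ℝ)

/-- The `C^r` topology on `𝓕` (product of the `C^r` topologies on the five feedbacks). -/
@[reducible] def ControlSystem.crTopology (r : ℕ∞) : TopologicalSpace ControlSystem :=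
  TopologicalSpace.induced ControlSystem.u₁₁ (SmoothFn.crTopology _ r) ⊓
  TopologicalSpace.induced ControlSystem.u₁₂ (SmoothFn.crTopology _ r) ⊓
  TopologicalSpace.induced ControlSystem.u₂ (SmoothFn.crTopology _ r) ⊓
  TopologicalSpace.induced ControlSystem.u₃ (SmoothFn.crTopology _ r) ⊓
  TopologicalSpace.induced ControlSystem.u₄ (SmoothFn.crTopology _ r)

/-- The closed-loop vector field on `(ℝ²)⁴` for the target `μ`. -/
def field (u : ControlSystem) (μ : Target) (x : Config) : Config :=
  ![u.u₁₁.1 (δ₁ μ, h₁ x) • z₁ x + u.u₁₂.1 (δ₁ μ, h₁ x) • z₅ x,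
    u.u₂.1 (δ₂ μ, h₂ x) • z₂ x,
    u.u₃.1 (δ₃ μ, h₃ x) • z₃ x,
    u.u₄.1 (δ₄ μ, h₄ x) • z₄ x]

/-- The infinitesimal rigid motion of the plane with angular velocity `w` and translation `b`,
acting on configurations. -/
def rigidField (w : ℝ) (b : Plane) (x : Config) : Config :=
  fun i => !₂[-w * x i 1 + b 0, w * x i 0 + b 1]

/-- The tangent space at `x` to the orbit of `x` under rotations and translations. -/
def orbitTangent (x : Config) : Submodule ℝ Config where
  carrier := {v | ∃ (w : ℝ) (b : Plane), v = rigidField w b x}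
  zero_mem' := ⟨0, 0, by ext i j; fin_cases j <;> simp [rigidField]⟩
  add_mem' := by
    rintro _ _ ⟨w, b, rfl⟩ ⟨w', b', rfl⟩
    refine ⟨w + w', b + b', ?_⟩
    ext i j; fin_cases j <;> simp [rigidField] <;> ring
  smul_mem' := by
    rintro c _ ⟨w, b, rfl⟩
    refine ⟨c * w, c • b, ?_⟩
    ext i j; fin_cases j <;> simp [rigidField] <;> ring

/-- The class of `x` modulo rigid motions is a stable equilibrium of the system induced by `u` and
`μ` on configurations modulo rigid motions. It is an equilibrium when the vector field at `x` is
tangent to the orbit of `x`, say equal to the infinitesimal rigid motion `ξ = (w, b)` at `x`; the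
linearization of the induced system is then the map induced on `(ℝ²)⁴ / T_x(orbit)` by the
derivative of `field - ξ` at `x`; and the equilibrium is stable when all the eigenvalues of the
linearization have negative real part. -/
def IsStableAt (u : ControlSystem) (μ : Target) (x : Config) : Prop :=
  ∃ (w : ℝ) (b : Plane), field u μ x = rigidField w b x ∧
    ∃ L : Config →L[ℝ] Config, HasFDerivAt (fun y => field u μ y - rigidField w b y) L x ∧
    ∃ hL : orbitTangent x ≤ (orbitTangent x).comap L.toLinearMap,
      ∀ s : ℂ, Polynomial.aeval s
          ((orbitTangent x).mapQ (orbitTangent x) L.toLinearMap hL).charpoly = 0 → s.re < 0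

/-- `u` locally stabilizes the framework parametrized by `μ`. -/
def LocallyStabilizes (u : ControlSystem) (μ : Target) : Prop :=
  IsStableAt u μ (framework μ)

/-- The property of elements of `𝓕` of locally stabilizing all frameworks in `E⁴`. -/
def StabilizesAll (u : ControlSystem) : Prop := ∀ μ : Target, LocallyStabilizes u μ

/-- `u` satisfies the property `P` robustly: `P` holds on a neighbourhood of `u` for the `C^r`
topology. -/
def Robustly (r : ℕ∞) (P : ControlSystem → Prop) (u : ControlSystem) : Prop :=
  ∃ N : Set ControlSystem, IsOpen[ControlSystem.crTopology r] N ∧ u ∈ N ∧ ∀ u' ∈ N, P u'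

/-- `u` locally stabilizes all frameworks, robustly in the sense that equilibria may move: each
framework is a stable equilibrium for `u`, and for all small perturbations of `u` there is still a
stable equilibrium arbitrarily close to it. -/
def RobustlyStabilizesAll (r : ℕ∞) (u : ControlSystem) : Prop :=
  ∀ μ : Target, LocallyStabilizes u μ ∧
    ∀ W ∈ 𝓝 (framework μ), Robustly r (fun u' => ∃ x ∈ W, IsStableAt u' μ x) u

end TwoCycles

end

noncomputable section

namespace TwoCycles

/-! Everything rests on the third claim. If some generic framework is not an equilibrium modulo
rigid motions, neither are the nearby ones, because the velocities `lengthRates` are continuous and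
vanish at every equilibrium.

Otherwise all generic frameworks are equilibria. Each agent knows only its own lengths, so this
forces every gain to vanish at its target (`feedback_eq_zero`, `gains_eq_zero`). Agent 1's gains
then vanish whatever the angle between its edges, so their derivative in the inner product is zero
too. In the coordinates given by half the squared lengths, the linearization becomes the product
`actuationMatrix * gainMatrix`, and stability in dimension five needs a negative determinant
(`det_neg_of_forall_root_re_neg`).

Up to a positive factor this determinant is `linDet`, a product of feedback derivatives and oriented
areas. One of these, `wedge z₃ z₂`, changes sign when agent 3 crosses the line through agents 1 and
2. Agent 1's factor `gainDet₁` sees only `z₁` and `z₅`, so it does not change when agent 3 moves,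
and the remaining factors keep their sign near the line if nonzero there. Hence `linDet` is positive
somewhere or vanishes on a nonempty open set of generic frameworks (`exists_isOpen_linDet_nonneg`),
and stability fails on an open set. -/

/-! ### Sign of the determinant of a stable linear map -/

/-- A monic polynomial of positive degree tends to `+∞`, so a nonpositive value at zero would
produce a root on `[0, ∞)` by the intermediate value theorem. -/
theorem polynomial_eval_zero_pos {p : Polynomial ℝ} (hp : p.Monic) (hdeg : 0 < p.degree)
    (h : ∀ s : ℝ, 0 ≤ s → p.eval s ≠ 0) : 0 < p.eval 0 := by
  by_contra hneg
  have hlim : Filter.Tendsto (fun x => p.eval x) Filter.atTop Filter.atTop :=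
    p.tendsto_atTop_of_leadingCoeff_nonneg hdeg (by rw [hp.leadingCoeff]; exact zero_le_one)
  obtain ⟨b, hb0, hb⟩ := ((Filter.eventually_ge_atTop (0 : ℝ)).and
    (hlim.eventually_ge_atTop 0)).exists
  obtain ⟨s, hs, hs0⟩ := intermediate_value_Icc hb0 (p.continuous.continuousOn (s := Set.Icc 0 b))
    (show (0 : ℝ) ∈ Set.Icc (p.eval 0) (p.eval b) from ⟨not_lt.1 hneg, hb⟩)
  exact h s hs.1 hs0

/-- If `R` identifies `V ⧸ T` with `ℝ⁵` and intertwines `L` with the matrix `M`, and all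
eigenvalues of the map induced by `L` on `V ⧸ T` have negative real part, then `det M < 0`. -/
theorem det_neg_of_forall_root_re_neg {V : Type*} [AddCommGroup V] [Module ℝ V]
    [Module.Finite ℝ V] (T : Submodule ℝ V) (L : V →ₗ[ℝ] V) (hL : T ≤ T.comap L)
    (R : V →ₗ[ℝ] (Fin 5 → ℝ)) (hker : LinearMap.ker R = T) (hsurj : Function.Surjective R)
    (M : Matrix (Fin 5) (Fin 5) ℝ) (hM : ∀ v, R (L v) = M.mulVec (R v))
    (hs : ∀ s : ℂ, Polynomial.aeval s (T.mapQ T L hL).charpoly = 0 → s.re < 0) :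
    M.det < 0 := by
  subst hker
  set e := R.quotKerEquivOfSurjective hsurj
  have hconj : e.conj ((LinearMap.ker R).mapQ (LinearMap.ker R) L hL) = Matrix.toLin' M := by
    ext1 i
    ext1
    simp only [LinearMap.comp_apply, LinearEquiv.conj_apply_apply]
    obtain ⟨v, hv⟩ := hsurj (LinearMap.single ℝ (fun _ => ℝ) i 1)
    have h1 : e.symm (LinearMap.single ℝ (fun _ => ℝ) i 1) = Submodule.Quotient.mk v := by
      rw [LinearEquiv.symm_apply_eq, ← hv]
      rfl
    rw [h1, Submodule.mapQ_apply, ← hv, Matrix.toLin'_apply, ← hM]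
    rfl
  have hchar : ((LinearMap.ker R).mapQ (LinearMap.ker R) L hL).charpoly = M.charpoly := by
    rw [← LinearEquiv.charpoly_conj e, hconj, Matrix.charpoly_toLin']
  rw [hchar] at hs
  have hpos : 0 < M.charpoly.eval 0 := by
    refine polynomial_eval_zero_pos M.charpoly_monic ?_ fun s hs0 hroot => ?_
    · rw [Matrix.charpoly_degree_eq_dim]; simp
    · have := hs (s : ℂ) (by
        have h2 := Polynomial.aeval_algebraMap_apply ℂ s M.charpoly
        simp only [Complex.coe_algebraMap, Polynomial.coe_aeval_eq_eval] at h2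
        rw [h2, hroot]; simp)
      simp at this
      linarith
  -- The dimension five is odd, so `det M` is minus the constant coefficient of the characteristic
  -- polynomial.
  rw [Matrix.det_eq_sign_charpoly_coeff, Polynomial.coeff_zero_eq_eval_zero]
  simp only [Fintype.card_fin]
  nlinarith

/-! ### Plane geometry: inner products, areas, rotations -/

/-- The oriented area spanned by two vectors of the plane. -/
def wedge (p q : Plane) : ℝ := p 0 * q 1 - p 1 * q 0

theorem inner_plane (p q : Plane) : inner ℝ p q = p 0 * q 0 + p 1 * q 1 := by
  simp [PiLp.inner_apply, Fin.sum_univ_two, mul_comm]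

theorem norm_sq_plane (p : Plane) : ‖p‖ ^ 2 = p 0 ^ 2 + p 1 ^ 2 := by
  rw [← real_inner_self_eq_norm_sq, inner_plane]; ring

theorem norm_plane (p : Plane) : ‖p‖ = √(p 0 ^ 2 + p 1 ^ 2) := by
  rw [← norm_sq_plane, Real.sqrt_sq (norm_nonneg p)]

theorem ne_zero_of_wedge_left {p q : Plane} (h : wedge p q ≠ 0) : p ≠ 0 := by
  rintro rfl; simp [wedge] at h

theorem ne_zero_of_wedge_right {p q : Plane} (h : wedge p q ≠ 0) : q ≠ 0 := by
  rintro rfl; simp [wedge] at h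

/-- A vector orthogonal to two independent vectors of the plane vanishes. -/
theorem eq_zero_of_inner_eq_zero {p q v : Plane} (h : wedge p q ≠ 0) (hp : inner ℝ p v = 0)
    (hq : inner ℝ q v = 0) : v = 0 := by
  rw [inner_plane] at hp hq
  ext i
  apply mul_left_cancel₀ h
  fin_cases i
  · change wedge p q * v 0 = wedge p q * 0
    rw [wedge]
    linear_combination q 1 * hp - p 1 * hq
  · change wedge p q * v 1 = wedge p q * 0
    rw [wedge]
    linear_combination p 0 * hq - q 0 * hp

theorem exists_inner_eq {p q : Plane} (h : wedge p q ≠ 0) (a b : ℝ) :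
    ∃ v : Plane, inner ℝ p v = a ∧ inner ℝ q v = b := by
  refine ⟨!₂[(a * q 1 - b * p 1) / wedge p q, (b * p 0 - a * q 0) / wedge p q], ?_, ?_⟩ <;>
  · rw [inner_plane]
    simp
    field_simp
    rw [wedge]
    ring

/-- Independent vectors have only the trivial linear relation. -/
theorem smul_add_smul_eq_zero {p q : Plane} (h : wedge p q ≠ 0) {a b : ℝ}
    (hab : a • p + b • q = 0) : a = 0 ∧ b = 0 := by
  have h0 : a * p 0 + b * q 0 = 0 := by simpa using congrArg (fun v : Plane => v 0) hab
  have h1 : a * p 1 + b * q 1 = 0 := by simpa using congrArg (fun v : Plane => v 1) hab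
  constructor <;> apply mul_left_cancel₀ h <;> simp only [wedge]
  · linear_combination q 1 * h0 - q 0 * h1
  · linear_combination p 0 * h1 - p 1 * h0

theorem rotate_sub (θ : ℝ) (p q : Plane) : rotate θ (p - q) = rotate θ p - rotate θ q := by
  ext i; fin_cases i <;> simp [rotate] <;> ring

theorem rotate_zero (θ : ℝ) : rotate θ 0 = 0 := by
  ext i; fin_cases i <;> simp [rotate]

theorem inner_rotate (θ : ℝ) (p q : Plane) :
    inner ℝ (rotate θ p) (rotate θ q) = inner ℝ p q := by
  simp only [inner_plane, rotate]
  simp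
  linear_combination (p 0 * q 0 + p 1 * q 1) * Real.sin_sq_add_cos_sq θ

theorem norm_rotate (θ : ℝ) (p : Plane) : ‖rotate θ p‖ = ‖p‖ := by
  rw [← sq_eq_sq₀ (norm_nonneg _) (norm_nonneg _), ← real_inner_self_eq_norm_sq, inner_rotate,
    real_inner_self_eq_norm_sq]

theorem wedge_rotate (θ : ℝ) (p q : Plane) : wedge (rotate θ p) (rotate θ q) = wedge p q := by
  simp only [wedge, rotate]
  simp
  linear_combination (p 0 * q 1 - p 1 * q 0) * Real.sin_sq_add_cos_sq θ

theorem continuous_wedge {X : Type*} [TopologicalSpace X] {f g : X → Plane} (hf : Continuous f)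
    (hg : Continuous g) : Continuous fun x => wedge (f x) (g x) := by
  unfold wedge; fun_prop

/-! ### The rigidity map and the actuation matrix -/

theorem z₁_add (x y : Config) : z₁ (x + y) = z₁ x + z₁ y := by simp [z₁]; abel

theorem z₂_add (x y : Config) : z₂ (x + y) = z₂ x + z₂ y := by simp [z₂]; abel

theorem z₃_add (x y : Config) : z₃ (x + y) = z₃ x + z₃ y := by simp [z₃]; abel

theorem z₄_add (x y : Config) : z₄ (x + y) = z₄ x + z₄ y := by simp [z₄]; abel

theorem z₅_add (x y : Config) : z₅ (x + y) = z₅ x + z₅ y := by simp [z₅]; abel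

theorem z₁_smul (c : ℝ) (x : Config) : z₁ (c • x) = c • z₁ x := by simp [z₁, smul_sub]

theorem z₂_smul (c : ℝ) (x : Config) : z₂ (c • x) = c • z₂ x := by simp [z₂, smul_sub]

theorem z₃_smul (c : ℝ) (x : Config) : z₃ (c • x) = c • z₃ x := by simp [z₃, smul_sub]

theorem z₄_smul (c : ℝ) (x : Config) : z₄ (c • x) = c • z₄ x := by simp [z₄, smul_sub]

theorem z₅_smul (c : ℝ) (x : Config) : z₅ (c • x) = c • z₅ x := by simp [z₅, smul_sub]

/-- The rigidity map at `x`: the derivative of half the squared edge lengths. -/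
def rigidity (x : Config) : Config →ₗ[ℝ] (Fin 5 → ℝ) where
  toFun v := ![inner ℝ (z₁ x) (z₁ v), inner ℝ (z₂ x) (z₂ v), inner ℝ (z₃ x) (z₃ v),
    inner ℝ (z₄ x) (z₄ v), inner ℝ (z₅ x) (z₅ v)]
  map_add' v w := by
    simp [z₁_add, z₂_add, z₃_add, z₄_add, z₅_add, inner_add_right]
  map_smul' c v := by
    simp [z₁_smul, z₂_smul, z₃_smul, z₄_smul, z₅_smul, inner_smul_right]

theorem rigidity_apply (x v : Config) : rigidity x v = ![inner ℝ (z₁ x) (z₁ v),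
    inner ℝ (z₂ x) (z₂ v), inner ℝ (z₃ x) (z₃ v), inner ℝ (z₄ x) (z₄ v),
    inner ℝ (z₅ x) (z₅ v)] := rfl

/-- The configuration velocity produced by the five gains `g`. -/
def actuate (x : Config) (g : Fin 5 → ℝ) : Config :=
  ![g 0 • z₁ x + g 1 • z₅ x, g 2 • z₂ x, g 3 • z₃ x, g 4 • z₄ x]

/-- The gains of the closed-loop system. -/
def gains (u : ControlSystem) (μ : Target) (x : Config) : Fin 5 → ℝ :=
  ![u.u₁₁.1 (δ₁ μ, h₁ x), u.u₁₂.1 (δ₁ μ, h₁ x), u.u₂.1 (δ₂ μ, h₂ x), u.u₃.1 (δ₃ μ, h₃ x),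
    u.u₄.1 (δ₄ μ, h₄ x)]

theorem field_eq_actuate (u : ControlSystem) (μ : Target) (x : Config) :
    field u μ x = actuate x (gains u μ x) := rfl

/-- The matrix of `rigidity x ∘ actuate x`. -/
def actuationMatrix (x : Config) : Matrix (Fin 5) (Fin 5) ℝ :=
  !![-inner ℝ (z₁ x) (z₁ x), -inner ℝ (z₁ x) (z₅ x), inner ℝ (z₁ x) (z₂ x), 0, 0;
     0, 0, -inner ℝ (z₂ x) (z₂ x), inner ℝ (z₂ x) (z₃ x), 0;
     inner ℝ (z₃ x) (z₁ x), inner ℝ (z₃ x) (z₅ x), 0, -inner ℝ (z₃ x) (z₃ x), 0;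
     0, 0, 0, inner ℝ (z₄ x) (z₃ x), -inner ℝ (z₄ x) (z₄ x);
     -inner ℝ (z₅ x) (z₁ x), -inner ℝ (z₅ x) (z₅ x), 0, 0, inner ℝ (z₅ x) (z₄ x)]

theorem rigidity_actuate (x : Config) (g : Fin 5 → ℝ) :
    rigidity x (actuate x g) = (actuationMatrix x).mulVec g := by
  have e1 : z₁ (actuate x g) = g 2 • z₂ x - (g 0 • z₁ x + g 1 • z₅ x) := rfl
  have e2 : z₂ (actuate x g) = g 3 • z₃ x - g 2 • z₂ x := rfl
  have e3 : z₃ (actuate x g) = (g 0 • z₁ x + g 1 • z₅ x) - g 3 • z₃ x := rfl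
  have e4 : z₄ (actuate x g) = g 3 • z₃ x - g 4 • z₄ x := rfl
  have e5 : z₅ (actuate x g) = g 4 • z₄ x - (g 0 • z₁ x + g 1 • z₅ x) := rfl
  rw [rigidity_apply, e1, e2, e3, e4, e5]
  ext i
  fin_cases i <;>
    simp [actuationMatrix, Matrix.mulVec, dotProduct, Fin.sum_univ_succ, inner_sub_right,
      inner_add_right, inner_smul_right, -inner_self_eq_norm_sq_to_K]
      <;> ring

/-- Both triangles close up, so all edges are expressed through `z₂`, `z₃`, `z₄` and the claim is a
polynomial identity. The factorization isolates `wedge z₃ z₂`, the area whose sign is exploited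
later. -/
theorem det_actuationMatrix (x : Config) : (actuationMatrix x).det =
    wedge (z₁ x) (z₅ x) * wedge (z₃ x) (z₂ x) * wedge (z₃ x) (z₄ x) *
      (‖z₄ x‖ ^ 2 * wedge (z₃ x) (z₂ x) - ‖z₂ x‖ ^ 2 * wedge (z₃ x) (z₄ x)) := by
  have h1 : z₁ x = -z₂ x - z₃ x := by simp only [z₁, z₂, z₃]; abel
  have h5 : z₅ x = -z₃ x - z₄ x := by simp only [z₅, z₄, z₃]; abel
  rw [actuationMatrix, h1, h5]
  generalize z₂ x = p
  generalize z₃ x = q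
  generalize z₄ x = s
  simp only [norm_sq_plane, inner_plane, wedge, PiLp.sub_apply, PiLp.neg_apply]
  simp [Matrix.det_succ_row_zero, Fin.sum_univ_succ, Fin.succAbove]
  ring

/-! ### Infinitesimal rigidity of generic configurations -/

/-- The edges at agent 1 are independent and no agent is on the line through agents 1 and 3. -/
def IsGeneric (x : Config) : Prop :=
  wedge (z₁ x) (z₅ x) ≠ 0 ∧ wedge (z₃ x) (z₂ x) ≠ 0 ∧ wedge (z₃ x) (z₄ x) ≠ 0

theorem wedge_z₁_z₂ (x : Config) : wedge (z₁ x) (z₂ x) = -wedge (z₃ x) (z₂ x) := by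
  simp [wedge, z₁, z₂, z₃]; ring

theorem wedge_z₁_z₃ (x : Config) : wedge (z₁ x) (z₃ x) = wedge (z₃ x) (z₂ x) := by
  simp [wedge, z₁, z₂, z₃]; ring

theorem wedge_z₅_z₄ (x : Config) : wedge (z₅ x) (z₄ x) = -wedge (z₃ x) (z₄ x) := by
  simp [wedge, z₅, z₄, z₃]; ring

theorem rigidity_rigidField (x : Config) (w : ℝ) (b : Plane) :
    rigidity x (rigidField w b x) = 0 := by
  ext i
  fin_cases i <;> simp [rigidity_apply, rigidField, z₁, z₂, z₃, z₄, z₅, inner_plane] <;> ring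

/-- The formation consists of two nondegenerate triangles sharing the edge `z₃`. Subtracting a rigid
motion brings agents 1 and 3 to rest; the velocities of agents 2 and 4 are then each orthogonal to
two independent edges. -/
theorem ker_rigidity {x : Config} (hx : IsGeneric x) :
    LinearMap.ker (rigidity x) = orbitTangent x := by
  apply le_antisymm
  · intro v hv
    rw [LinearMap.mem_ker, rigidity_apply] at hv
    have hv1 : inner ℝ (z₁ x) (z₁ v) = 0 := congrFun hv 0
    have hv2 : inner ℝ (z₂ x) (z₂ v) = 0 := congrFun hv 1
    have hv3 : inner ℝ (z₃ x) (z₃ v) = 0 := congrFun hv 2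
    have hv4 : inner ℝ (z₄ x) (z₄ v) = 0 := congrFun hv 3
    have hv5 : inner ℝ (z₅ x) (z₅ v) = 0 := congrFun hv 4
    have h3 : 0 < ‖z₃ x‖ ^ 2 := by
      have := ne_zero_of_wedge_left hx.2.1
      positivity
    -- The angular velocity of the edge `z₃` under `v`; the translation is then chosen so that agent
    -- 1 is at rest in `y`.
    set w := wedge (z₃ x) (z₃ v) / ‖z₃ x‖ ^ 2 with hw
    set y : Config := v - rigidField w !₂[v 0 0 + w * x 0 1, v 0 1 - w * x 0 0] x with hy
    have hR : rigidity x y = 0 := by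
      rw [hy, map_sub, rigidity_rigidField, rigidity_apply, hv, sub_zero]
    have hy0 : y 0 = 0 := by
      ext i; fin_cases i <;> simp [hy, rigidField]
    have hw' : w * ((x 0 0 - x 2 0) ^ 2 + (x 0 1 - x 2 1) ^ 2) =
        (x 0 0 - x 2 0) * (v 0 1 - v 2 1) - (x 0 1 - x 2 1) * (v 0 0 - v 2 0) := by
      rw [hw, norm_sq_plane]
      rw [norm_sq_plane] at h3
      simp only [wedge, z₃, PiLp.sub_apply] at h3 ⊢
      field_simp
    have hy2 : y 2 = 0 := by
      rw [norm_sq_plane] at h3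
      rw [inner_plane] at hv3
      simp only [z₃, PiLp.sub_apply] at h3 hv3
      ext i
      apply mul_left_cancel₀ h3.ne'
      fin_cases i
      · have hy20 : y 2 0 = v 2 0 - (-w * x 2 1 + (v 0 0 + w * x 0 1)) := rfl
        change _ * y 2 0 = _ * 0
        rw [hy20]
        linear_combination -(x 0 0 - x 2 0) * hv3 - (x 0 1 - x 2 1) * hw'
      · have hy21 : y 2 1 = v 2 1 - (w * x 2 0 + (v 0 1 - w * x 0 0)) := rfl
        change _ * y 2 1 = _ * 0
        rw [hy21]
        linear_combination -(x 0 1 - x 2 1) * hv3 + (x 0 0 - x 2 0) * hw'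
    have hy1 : y 1 = 0 := by
      have hR1 : inner ℝ (z₁ x) (z₁ y) = 0 := congrFun hR 0
      have hR2 : inner ℝ (z₂ x) (z₂ y) = 0 := congrFun hR 1
      rw [z₁, z₁, hy0, sub_zero] at hR1
      rw [z₂, z₂, hy2, zero_sub, inner_neg_right, neg_eq_zero] at hR2
      refine eq_zero_of_inner_eq_zero (p := z₁ x) (q := z₂ x) ?_ hR1 hR2
      rw [wedge_z₁_z₂]
      exact neg_ne_zero.2 hx.2.1
    have hy3 : y 3 = 0 := by
      have hR4 : inner ℝ (z₄ x) (z₄ y) = 0 := congrFun hR 3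
      have hR5 : inner ℝ (z₅ x) (z₅ y) = 0 := congrFun hR 4
      rw [z₅, z₅, hy0, sub_zero] at hR5
      rw [z₄, z₄, hy2, zero_sub, inner_neg_right, neg_eq_zero] at hR4
      refine eq_zero_of_inner_eq_zero (p := z₅ x) (q := z₄ x) ?_ hR5 hR4
      rw [wedge_z₅_z₄]
      exact neg_ne_zero.2 hx.2.2
    have hyz : y = 0 := by
      ext1 i; fin_cases i <;> assumption
    exact ⟨_, _, sub_eq_zero.1 hyz⟩
  · rintro _ ⟨w, b, rfl⟩
    exact rigidity_rigidField x w b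

/-- With agent 1 at rest, agent 3 moves along `z₃` to realize `e 2`. Each of agents 2 and 4 then has
two independent linear conditions on its velocity. -/
theorem rigidity_surjective {x : Config} (hx : IsGeneric x) :
    Function.Surjective (rigidity x) := by
  intro e
  have h3 : ‖z₃ x‖ ^ 2 ≠ 0 := by
    have := ne_zero_of_wedge_left hx.2.1
    positivity
  set c : Plane := -(e 2 / ‖z₃ x‖ ^ 2) • z₃ x with hc
  obtain ⟨p, hp1, hp2⟩ := exists_inner_eq (p := z₁ x) (q := z₂ x)
    (by rw [wedge_z₁_z₂]; exact neg_ne_zero.2 hx.2.1) (e 0) (inner ℝ (z₂ x) c - e 1)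
  obtain ⟨q, hq1, hq2⟩ := exists_inner_eq (p := z₅ x) (q := z₄ x)
    (by rw [wedge_z₅_z₄]; exact neg_ne_zero.2 hx.2.2) (e 4) (inner ℝ (z₄ x) c - e 3)
  refine ⟨![0, p, c, q], ?_⟩
  have e1 : z₁ ![0, p, c, q] = p := sub_zero p
  have e2 : z₂ ![0, p, c, q] = c - p := rfl
  have e3 : z₃ ![0, p, c, q] = -c := zero_sub c
  have e4 : z₄ ![0, p, c, q] = c - q := rfl
  have e5 : z₅ ![0, p, c, q] = q := sub_zero q
  rw [rigidity_apply, e1, e2, e3, e4, e5, inner_sub_right, inner_sub_right, hp1, hp2, hq1, hq2]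
  have h33 : inner ℝ (z₃ x) (-c) = e 2 := by
    rw [hc, neg_smul, neg_neg, inner_smul_right, real_inner_self_eq_norm_sq,
      div_mul_cancel₀ _ h3]
  rw [h33]
  ext i
  fin_cases i <;> simp

/-! ### Linearization of the closed loop -/

/-- The derivative of a feedback `u(δ; h)` in the observation, at `h = δ = d`. -/
def obsDeriv (u : SmoothFn (ℝ × ℝ)) (d : ℝ) : ℝ := fderiv ℝ u.1 (d, d) (0, 1)

/-- The derivative of a feedback of agent 1 at `((d₁, d₅), (d₁, d₅, c))` in the direction `v` of
the observations. -/
def obsDeriv₁ (u : SmoothFn ((ℝ × ℝ) × (ℝ × ℝ × ℝ))) (d : ℝ × ℝ) (c : ℝ) (v : ℝ × ℝ × ℝ) : ℝ :=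
  fderiv ℝ u.1 (d, d.1, d.2, c) (0, v)

/-- The gain determinant of agent 1. -/
def gainDet₁ (u : ControlSystem) (d : ℝ × ℝ) (c : ℝ) : ℝ :=
  obsDeriv₁ u.u₁₁ d c (0, 1, 0) * obsDeriv₁ u.u₁₂ d c (1, 0, 0) -
    obsDeriv₁ u.u₁₁ d c (1, 0, 0) * obsDeriv₁ u.u₁₂ d c (0, 1, 0)

/-- The derivative of the gains with respect to half the squared edge lengths. -/
def gainMatrix (u : ControlSystem) (x : Config) : Matrix (Fin 5) (Fin 5) ℝ :=
  !![obsDeriv₁ u.u₁₁ (‖z₁ x‖, ‖z₅ x‖) (inner ℝ (z₁ x) (z₅ x)) (1, 0, 0) / ‖z₁ x‖, 0, 0, 0,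
      obsDeriv₁ u.u₁₁ (‖z₁ x‖, ‖z₅ x‖) (inner ℝ (z₁ x) (z₅ x)) (0, 1, 0) / ‖z₅ x‖;
     obsDeriv₁ u.u₁₂ (‖z₁ x‖, ‖z₅ x‖) (inner ℝ (z₁ x) (z₅ x)) (1, 0, 0) / ‖z₁ x‖, 0, 0, 0,
      obsDeriv₁ u.u₁₂ (‖z₁ x‖, ‖z₅ x‖) (inner ℝ (z₁ x) (z₅ x)) (0, 1, 0) / ‖z₅ x‖;
     0, obsDeriv u.u₂ ‖z₂ x‖ / ‖z₂ x‖, 0, 0, 0;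
     0, 0, obsDeriv u.u₃ ‖z₃ x‖ / ‖z₃ x‖, 0, 0;
     0, 0, 0, obsDeriv u.u₄ ‖z₄ x‖ / ‖z₄ x‖, 0]

/-- The permutation sending row 0 to column 4 and each other row to the preceding column is an even
5-cycle; this fixes the order of the two products in `gainDet₁`. -/
theorem det_gainMatrix (u : ControlSystem) (x : Config) : (gainMatrix u x).det =
    obsDeriv u.u₂ ‖z₂ x‖ * obsDeriv u.u₃ ‖z₃ x‖ * obsDeriv u.u₄ ‖z₄ x‖ *
      gainDet₁ u (‖z₁ x‖, ‖z₅ x‖) (inner ℝ (z₁ x) (z₅ x)) *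
      (‖z₁ x‖⁻¹ * ‖z₂ x‖⁻¹ * ‖z₃ x‖⁻¹ * ‖z₄ x‖⁻¹ * ‖z₅ x‖⁻¹) := by
  rw [gainMatrix, gainDet₁]
  simp [Matrix.det_succ_row_zero, Fin.sum_univ_succ, Fin.succAbove]
  ring

theorem SmoothFn.hasFDerivAt {E : Type} [NormedAddCommGroup E] [NormedSpace ℝ E]
    (u : SmoothFn E) (x : E) : HasFDerivAt u.1 (fderiv ℝ u.1 x) x :=
  (u.2.differentiable (by simp) x).hasFDerivAt

theorem SmoothFn.continuous_fderiv_apply {E : Type} [NormedAddCommGroup E] [NormedSpace ℝ E]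
    (u : SmoothFn E) (v : E) : Continuous fun x => fderiv ℝ u.1 x v :=
  (u.2.continuous_fderiv (by simp)).clm_apply continuous_const

theorem hasDerivAt_norm_add_smul {p : Plane} (hp : p ≠ 0) (q : Plane) :
    HasDerivAt (fun t : ℝ => ‖p + t • q‖) (inner ℝ p q / ‖p‖) 0 := by
  have h1 : HasDerivAt (fun t : ℝ => p + t • q) q 0 := by
    simpa using ((hasDerivAt_id (0 : ℝ)).smul_const q).const_add p
  have h2 := h1.norm_sq.sqrt (by simpa using hp)
  simp only [Real.sqrt_sq (norm_nonneg _), zero_smul, add_zero] at h2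
  convert h2 using 1
  field_simp

theorem hasDerivAt_inner_add_smul (p q p' q' : Plane) :
    HasDerivAt (fun t : ℝ => inner ℝ (p + t • p') (q + t • q'))
      (inner ℝ p q' + inner ℝ p' q) 0 := by
  have h1 : ∀ p p' : Plane, HasDerivAt (fun t : ℝ => p + t • p') p' 0 := fun p p' => by
    simpa using ((hasDerivAt_id (0 : ℝ)).smul_const p').const_add p
  simpa using (h1 p p').inner ℝ (h1 q q')

/-- Where a gain vanishes, the motion of the edge itself does not contribute to first order. -/
theorem hasDerivAt_smul_add_smul {g : ℝ → ℝ} {g' : ℝ} (hg : HasDerivAt g g' 0) (hg0 : g 0 = 0)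
    (p q : Plane) : HasDerivAt (fun t : ℝ => g t • (p + t • q)) (g' • p) 0 := by
  have h1 : HasDerivAt (fun t : ℝ => p + t • q) q 0 := by
    simpa using ((hasDerivAt_id (0 : ℝ)).smul_const q).const_add p
  exact (hg.smul h1).congr_deriv (by simp [hg0])

theorem hasDerivAt_actuate {g : ℝ → Fin 5 → ℝ} {g' : Fin 5 → ℝ} (hg : HasDerivAt g g' 0)
    (hg0 : g 0 = 0) (x v : Config) :
    HasDerivAt (fun t : ℝ => actuate (x + t • v) (g t)) (actuate x g') 0 := by
  rw [hasDerivAt_pi] at hg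
  have hg0' : ∀ i, g 0 i = 0 := fun i => congrFun hg0 i
  rw [hasDerivAt_pi]
  intro i
  simp only [actuate, z₁_add, z₂_add, z₃_add, z₄_add, z₅_add, z₁_smul, z₂_smul, z₃_smul, z₄_smul,
    z₅_smul]
  fin_cases i
  · exact (hasDerivAt_smul_add_smul (hg 0) (hg0' 0) _ _).add
      (hasDerivAt_smul_add_smul (hg 1) (hg0' 1) _ _)
  · exact hasDerivAt_smul_add_smul (hg 2) (hg0' 2) _ _
  · exact hasDerivAt_smul_add_smul (hg 3) (hg0' 3) _ _
  · exact hasDerivAt_smul_add_smul (hg 4) (hg0' 4) _ _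

theorem hasDerivAt_obs (u : SmoothFn (ℝ × ℝ)) {p : Plane} (hp : p ≠ 0) (q : Plane) :
    HasDerivAt (fun t : ℝ => u.1 (‖p‖, ‖p + t • q‖)) (obsDeriv u ‖p‖ / ‖p‖ * inner ℝ p q) 0 := by
  have h1 := (hasDerivAt_const (0 : ℝ) ‖p‖).prodMk (hasDerivAt_norm_add_smul hp q)
  have h2 : HasFDerivAt u.1 (fderiv ℝ u.1 (‖p‖, ‖p‖)) (‖p‖, ‖p + (0 : ℝ) • q‖) := by
    simpa using u.hasFDerivAt (‖p‖, ‖p‖)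
  have h3 := h2.comp_hasDerivAt (0 : ℝ) h1
  refine h3.congr_deriv ?_
  have h4 : ((0 : ℝ), inner ℝ p q / ‖p‖) = (inner ℝ p q / ‖p‖) • ((0 : ℝ), (1 : ℝ)) := by simp
  rw [h4, map_smul, obsDeriv, smul_eq_mul]
  field_simp

/-- The hypothesis `hu` removes the inner-product direction, leaving only the changes of the two
lengths; this is what lets the linearization factor through the rigidity map. -/
theorem hasDerivAt_obs₁ (u : SmoothFn ((ℝ × ℝ) × (ℝ × ℝ × ℝ))) {p q : Plane} (hp : p ≠ 0)
    (hq : q ≠ 0) (hu : obsDeriv₁ u (‖p‖, ‖q‖) (inner ℝ p q) (0, 0, 1) = 0) (p' q' : Plane) :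
    HasDerivAt (fun t : ℝ => u.1 ((‖p‖, ‖q‖), ‖p + t • p'‖, ‖q + t • q'‖,
        inner ℝ (p + t • p') (q + t • q')))
      (obsDeriv₁ u (‖p‖, ‖q‖) (inner ℝ p q) (1, 0, 0) / ‖p‖ * inner ℝ p p' +
        obsDeriv₁ u (‖p‖, ‖q‖) (inner ℝ p q) (0, 1, 0) / ‖q‖ * inner ℝ q q') 0 := by
  have h1 := (hasDerivAt_const (0 : ℝ) (‖p‖, ‖q‖)).prodMk ((hasDerivAt_norm_add_smul hp p').prodMk
    ((hasDerivAt_norm_add_smul hq q').prodMk (hasDerivAt_inner_add_smul p q p' q')))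
  have h2 : HasFDerivAt u.1 (fderiv ℝ u.1 ((‖p‖, ‖q‖), ‖p‖, ‖q‖, inner ℝ p q))
      ((‖p‖, ‖q‖), ‖p + (0 : ℝ) • p'‖, ‖q + (0 : ℝ) • q'‖,
        inner ℝ (p + (0 : ℝ) • p') (q + (0 : ℝ) • q')) := by
    simpa using u.hasFDerivAt ((‖p‖, ‖q‖), ‖p‖, ‖q‖, inner ℝ p q)
  have h3 := h2.comp_hasDerivAt (0 : ℝ) h1
  refine h3.congr_deriv ?_
  have h4 : ∀ a b c : ℝ, (((0, 0), a, b, c) : (ℝ × ℝ) × (ℝ × ℝ × ℝ)) =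
      a • (0, 1, 0, 0) + b • (0, 0, 1, 0) + c • (0, 0, 0, 1) := by
    intro a b c; simp
  rw [show (0 : ℝ × ℝ) = (0, 0) from rfl, h4, map_add, map_add, map_smul, map_smul, map_smul]
  simp only [obsDeriv₁] at hu ⊢
  rw [hu]
  simp only [smul_eq_mul]
  field_simp
  ring

theorem hasDerivAt_gains (u : ControlSystem) {μ : Target} (hμ : IsGeneric (framework μ))
    (h₁₁ : obsDeriv₁ u.u₁₁ (δ₁ μ) (h₁ (framework μ)).2.2 (0, 0, 1) = 0)
    (h₁₂ : obsDeriv₁ u.u₁₂ (δ₁ μ) (h₁ (framework μ)).2.2 (0, 0, 1) = 0) (v : Config) :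
    HasDerivAt (fun t : ℝ => gains u μ (framework μ + t • v))
      ((gainMatrix u (framework μ)).mulVec (rigidity (framework μ) v)) 0 := by
  have hz1 := ne_zero_of_wedge_left hμ.1
  have hz5 := ne_zero_of_wedge_right hμ.1
  have hz2 := ne_zero_of_wedge_right hμ.2.1
  have hz3 := ne_zero_of_wedge_left hμ.2.1
  have hz4 := ne_zero_of_wedge_right hμ.2.2
  rw [hasDerivAt_pi]
  intro i
  simp only [gains, h₁, h₂, h₃, h₄, z₁_add, z₂_add, z₃_add, z₄_add, z₅_add, z₁_smul, z₂_smul,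
    z₃_smul, z₄_smul, z₅_smul]
  fin_cases i
  · refine (hasDerivAt_obs₁ u.u₁₁ hz1 hz5 h₁₁ (z₁ v) (z₅ v)).congr_deriv ?_
    simp [gainMatrix, rigidity_apply, Matrix.mulVec, dotProduct, Fin.sum_univ_succ]
  · refine (hasDerivAt_obs₁ u.u₁₂ hz1 hz5 h₁₂ (z₁ v) (z₅ v)).congr_deriv ?_
    simp [gainMatrix, rigidity_apply, Matrix.mulVec, dotProduct, Fin.sum_univ_succ]
  · refine (hasDerivAt_obs u.u₂ hz2 (z₂ v)).congr_deriv ?_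
    simp [gainMatrix, rigidity_apply, Matrix.mulVec, dotProduct, Fin.sum_univ_succ]
  · refine (hasDerivAt_obs u.u₃ hz3 (z₃ v)).congr_deriv ?_
    simp [gainMatrix, rigidity_apply, Matrix.mulVec, dotProduct, Fin.sum_univ_succ]
  · refine (hasDerivAt_obs u.u₄ hz4 (z₄ v)).congr_deriv ?_
    simp [gainMatrix, rigidity_apply, Matrix.mulVec, dotProduct, Fin.sum_univ_succ]

/-- Up to a positive factor, the determinant of the linearization in the edge lengths. -/
def linDet (u : ControlSystem) (x : Config) : ℝ :=
  obsDeriv u.u₂ ‖z₂ x‖ * obsDeriv u.u₃ ‖z₃ x‖ * obsDeriv u.u₄ ‖z₄ x‖ *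
    gainDet₁ u (‖z₁ x‖, ‖z₅ x‖) (inner ℝ (z₁ x) (z₅ x)) *
    (wedge (z₁ x) (z₅ x) * wedge (z₃ x) (z₂ x) * wedge (z₃ x) (z₄ x) *
      (‖z₄ x‖ ^ 2 * wedge (z₃ x) (z₂ x) - ‖z₂ x‖ ^ 2 * wedge (z₃ x) (z₄ x)))

/-- Agents 1 and 3 are distinct, and a rigid motion fixing two points is trivial. So the motion
allowed in `IsStableAt` is zero wherever the field vanishes. -/
theorem rigidField_eq_zero {x : Config} (hx : IsGeneric x) {w : ℝ} {b : Plane}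
    (h : rigidField w b x = 0) : w = 0 ∧ b = 0 := by
  have hc : ∀ i j, rigidField w b x i j = 0 := fun i j => by rw [h]; rfl
  have h20 : -w * x 2 1 + b 0 = 0 := hc 2 0
  have h21 : w * x 2 0 + b 1 = 0 := hc 2 1
  have h00 : -w * x 0 1 + b 0 = 0 := hc 0 0
  have h01 : w * x 0 0 + b 1 = 0 := hc 0 1
  have hw : w = 0 := by
    by_contra hw
    apply ne_zero_of_wedge_left hx.2.1
    ext j
    apply mul_left_cancel₀ hw
    fin_cases j
    · change w * (x 0 0 - x 2 0) = w * 0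
      linear_combination h01 - h21
    · change w * (x 0 1 - x 2 1) = w * 0
      linear_combination h20 - h00
  subst hw
  refine ⟨rfl, ?_⟩
  ext j
  fin_cases j
  · simpa using h00
  · simpa using h01

/-- The derivative of the field is `actuate ∘ gainMatrix ∘ rigidity`, so the rigidity map
intertwines it with `actuationMatrix * gainMatrix`, whose determinant must be negative. -/
theorem linDet_neg_of_isStableAt {u : ControlSystem} {μ : Target} (hμ : IsGeneric (framework μ))
    (hg : gains u μ (framework μ) = 0)
    (h₁₁ : obsDeriv₁ u.u₁₁ (δ₁ μ) (h₁ (framework μ)).2.2 (0, 0, 1) = 0)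
    (h₁₂ : obsDeriv₁ u.u₁₂ (δ₁ μ) (h₁ (framework μ)).2.2 (0, 0, 1) = 0)
    (hs : IsStableAt u μ (framework μ)) : linDet u (framework μ) < 0 := by
  obtain ⟨w, b, hwb, L, hL, hLT, hroot⟩ := hs
  have hz1 := ne_zero_of_wedge_left hμ.1
  have hz5 := ne_zero_of_wedge_right hμ.1
  have hz2 := ne_zero_of_wedge_right hμ.2.1
  have hz3 := ne_zero_of_wedge_left hμ.2.1
  have hz4 := ne_zero_of_wedge_right hμ.2.2
  have hf0 : field u μ (framework μ) = 0 := by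
    rw [field_eq_actuate, hg]
    ext1 i; fin_cases i <;> simp [actuate]
  obtain ⟨rfl, rfl⟩ := rigidField_eq_zero hμ (hwb.symm.trans hf0)
  have hrig : ∀ y, rigidField 0 0 y = 0 := by
    intro y; ext i j; fin_cases j <;> simp [rigidField]
  simp only [hrig, sub_zero] at hL
  have hLv : ∀ v, L v = actuate (framework μ)
      ((gainMatrix u (framework μ)).mulVec (rigidity (framework μ) v)) := by
    intro v
    have hc : HasDerivAt (fun t : ℝ => framework μ + t • v) v 0 := by
      simpa using ((hasDerivAt_id (0 : ℝ)).smul_const v).const_add (framework μ)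
    have hL0 : HasFDerivAt (fun y => field u μ y) L (framework μ + (0 : ℝ) • v) := by
      simpa using hL
    refine (hL0.comp_hasDerivAt (0 : ℝ) hc).unique ?_
    exact hasDerivAt_actuate (hasDerivAt_gains u hμ h₁₁ h₁₂ v) (by simpa using hg) _ _
  have hdet := det_neg_of_forall_root_re_neg _ _ hLT (rigidity (framework μ)) (ker_rigidity hμ)
    (rigidity_surjective hμ) (actuationMatrix (framework μ) * gainMatrix u (framework μ))
    (fun v => by
      rw [ContinuousLinearMap.coe_coe, hLv, rigidity_actuate, Matrix.mulVec_mulVec]) hroot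
  rw [Matrix.det_mul, det_actuationMatrix, det_gainMatrix] at hdet
  have hpos : 0 < ‖z₁ (framework μ)‖⁻¹ * ‖z₂ (framework μ)‖⁻¹ * ‖z₃ (framework μ)‖⁻¹ *
      ‖z₄ (framework μ)‖⁻¹ * ‖z₅ (framework μ)‖⁻¹ := by positivity
  rw [← mul_assoc, mul_comm] at hdet
  rw [linDet, mul_comm]
  exact neg_of_mul_neg_right hdet hpos.le

/-! ### Equilibrium everywhere forces the gains to vanish -/

/-- The velocities of half the squared edge lengths of the target framework. -/
def lengthRates (u : ControlSystem) (μ : Target) : Fin 5 → ℝ :=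
  (actuationMatrix (framework μ)).mulVec (gains u μ (framework μ))

theorem lengthRates_eq_zero_of_locallyStabilizes {u : ControlSystem} {μ : Target}
    (h : LocallyStabilizes u μ) : lengthRates u μ = 0 := by
  obtain ⟨w, b, hwb, -⟩ := h
  rw [lengthRates, ← rigidity_actuate, ← field_eq_actuate, hwb, rigidity_rigidField]

theorem norm_eq_of_sq_add_sq {p : Plane} {a : ℝ} (ha : 0 ≤ a) (h : p 0 ^ 2 + p 1 ^ 2 = a ^ 2) :
    ‖p‖ = a := by
  rw [norm_plane, h, Real.sqrt_sq ha]

theorem lengthRates_one (u : ControlSystem) (μ : Target) : lengthRates u μ 1 =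
    -inner ℝ (z₂ (framework μ)) (z₂ (framework μ)) * u.u₂.1 (δ₂ μ, δ₂ μ) +
      inner ℝ (z₂ (framework μ)) (z₃ (framework μ)) * u.u₃.1 (δ₃ μ, δ₃ μ) := by
  simp [lengthRates, actuationMatrix, gains, Matrix.mulVec, dotProduct, Fin.sum_univ_succ, δ₂, δ₃,
    h₂, h₃]

theorem lengthRates_three (u : ControlSystem) (μ : Target) : lengthRates u μ 3 =
    inner ℝ (z₄ (framework μ)) (z₃ (framework μ)) * u.u₃.1 (δ₃ μ, δ₃ μ) +
      -inner ℝ (z₄ (framework μ)) (z₄ (framework μ)) * u.u₄.1 (δ₄ μ, δ₄ μ) := by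
  simp [lengthRates, actuationMatrix, gains, Matrix.mulVec, dotProduct, Fin.sum_univ_succ, δ₃, δ₄,
    h₃, h₄]

/-- If all generic frameworks are equilibria, then the feedbacks of agents 2, 3 and 4 vanish at
their targets. -/
theorem feedback_eq_zero {u : ControlSystem}
    (hE : ∀ μ, IsGeneric (framework μ) → lengthRates u μ = 0) {t s r : ℝ} (ht : 0 < t)
    (hs : 0 < s) (hr : 0 < r) :
    u.u₂.1 (t, t) = 0 ∧ u.u₃.1 (s, s) = 0 ∧ u.u₄.1 (r, r) = 0 := by
  have key : ∀ a b : ℝ, 0 ≤ a → 0 < b → a ^ 2 + b ^ 2 = t ^ 2 →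
      -t ^ 2 * u.u₂.1 (t, t) + a * s * u.u₃.1 (s, s) = 0 ∧ r ^ 2 * u.u₄.1 (r, r) = 0 := by
    intro a b ha hb hab
    -- Here `z₂ = (-a, b)`, `z₃ = (-s, 0)` and `z₄ = (0, -r)`. Since `z₄` is orthogonal to `z₃`,
    -- agent 4's equation decouples, while `a` varies the angle at agent 3 with all three lengths
    -- fixed.
    set μ : Target := ![!₂[s + a, -b], !₂[s, 0], !₂[s, r]] with hμ
    have hg : IsGeneric (framework μ) := by
      refine ⟨?_, ?_, ?_⟩ <;> simp [hμ, wedge, framework, z₁, z₂, z₃, z₄, z₅]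
      · have : 0 < (s + a) * r + b * s := by positivity
        exact this.ne'
      · exact ⟨hs.ne', hb.ne'⟩
      · exact ⟨hs.ne', hr.ne'⟩
    have h2 : δ₂ μ = t := norm_eq_of_sq_add_sq ht.le (by simp [hμ, framework, z₂, hab])
    have h3 : δ₃ μ = s := norm_eq_of_sq_add_sq hs.le (by simp [hμ, framework, z₃])
    have h4 : δ₄ μ = r := norm_eq_of_sq_add_sq hr.le (by simp [hμ, framework, z₄])
    have e1 := congrFun (hE μ hg) 1
    have e3 := congrFun (hE μ hg) 3
    rw [lengthRates_one, h2, h3] at e1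
    rw [lengthRates_three, h3, h4] at e3
    simp only [inner_plane] at e1 e3
    simp [hμ, framework, z₂, z₃, z₄] at e1 e3
    refine ⟨?_, ?_⟩
    · rw [← hab]; linear_combination e1
    · rcases e3 with e3 | e3
      · exact absurd e3 hr.ne'
      · rw [e3, mul_zero]
  -- A right angle (`a = 0`) isolates `u₂` and `u₄`; the 3-4-5 triangle then isolates `u₃`.
  obtain ⟨ha2, ha4⟩ := key 0 t le_rfl ht (by ring)
  obtain ⟨hb2, -⟩ := key (3 / 5 * t) (4 / 5 * t) (by positivity) (by positivity) (by ring)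
  have hu2 : u.u₂.1 (t, t) = 0 := by
    have := pow_pos ht 2
    apply mul_left_cancel₀ this.ne'
    linear_combination -ha2
  refine ⟨hu2, ?_, ?_⟩
  · rw [hu2] at hb2
    have : 0 < 3 / 5 * t * s := by positivity
    apply mul_left_cancel₀ this.ne'
    linear_combination hb2
  · have := pow_pos hr 2
    apply mul_left_cancel₀ this.ne'
    linear_combination ha4

/-- Once agents 2 and 3 are at rest, agent 1's velocity is orthogonal to the independent edges `z₁`
and `z₃`, hence zero; independence of `z₁` and `z₅` then kills both of its gains. -/
theorem gains_eq_zero {u : ControlSystem}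
    (hE : ∀ μ, IsGeneric (framework μ) → lengthRates u μ = 0) {μ : Target}
    (hμ : IsGeneric (framework μ)) : gains u μ (framework μ) = 0 := by
  have hz2 := ne_zero_of_wedge_right hμ.2.1
  have hz3 := ne_zero_of_wedge_left hμ.2.1
  have hz4 := ne_zero_of_wedge_right hμ.2.2
  obtain ⟨g2, g3, g4⟩ := feedback_eq_zero hE (norm_pos_iff.2 hz2) (norm_pos_iff.2 hz3)
    (norm_pos_iff.2 hz4)
  set g := gains u μ (framework μ) with hg
  have g2' : g 2 = 0 := g2
  have g3' : g 3 = 0 := g3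
  have g4' : g 4 = 0 := g4
  have e0 := congrFun (hE μ hμ) 0
  have e2 := congrFun (hE μ hμ) 2
  rw [lengthRates, ← hg] at e0 e2
  simp [actuationMatrix, Matrix.mulVec, dotProduct, Fin.sum_univ_succ,
    -inner_self_eq_norm_sq_to_K] at e0 e2
  change _ + (_ + inner ℝ (z₁ (framework μ)) (z₂ (framework μ)) * g 2) = 0 at e0
  change _ + (_ + -(_ * g 3)) = 0 at e2
  have hy : g 0 • z₁ (framework μ) + g 1 • z₅ (framework μ) = 0 := by
    refine eq_zero_of_inner_eq_zero (p := z₁ (framework μ)) (q := z₃ (framework μ)) ?_ ?_ ?_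
    · rw [wedge_z₁_z₃]; exact hμ.2.1
    · rw [inner_add_right, inner_smul_right, inner_smul_right]
      rw [g2'] at e0
      linear_combination -e0
    · rw [inner_add_right, inner_smul_right, inner_smul_right]
      rw [g3'] at e2
      linear_combination e2
  obtain ⟨g0, g1⟩ := smul_add_smul_eq_zero hμ.1 hy
  ext1 i
  fin_cases i <;> assumption

/-- Every admissible observation of agent 1 comes from a generic framework. -/
theorem exists_isGeneric {a b c : ℝ} (ha : 0 < a) (hb : 0 < b) (hc : c ^ 2 < (a * b) ^ 2) :
    ∃ μ : Target, IsGeneric (framework μ) ∧ δ₁ μ = (a, b) ∧ h₁ (framework μ) = (a, b, c) := by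
  have hpos : 0 < b ^ 2 - (c / a) ^ 2 := by
    rw [div_pow, sub_pos, div_lt_iff₀ (by positivity)]
    linarith [mul_pow a b 2]
  set k := √(b ^ 2 - (c / a) ^ 2) with hk
  have hk0 : 0 < k := Real.sqrt_pos.2 hpos
  have hk2 : k ^ 2 = b ^ 2 - (c / a) ^ 2 := Real.sq_sqrt hpos.le
  -- Agent 4 is placed so that `z₅ = (c / a, k)`, and agent 3 completes the parallelogram.
  set μ : Target := ![!₂[a, 0], !₂[a + c / a, k], !₂[c / a, k]] with hμ
  have n1 : ‖z₁ (framework μ)‖ = a :=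
    norm_eq_of_sq_add_sq ha.le (by simp [hμ, framework, z₁])
  have n5 : ‖z₅ (framework μ)‖ = b :=
    norm_eq_of_sq_add_sq hb.le (by simp [hμ, framework, z₅, hk2])
  refine ⟨μ, ⟨?_, ?_, ?_⟩, ?_, ?_⟩
  · simp [hμ, wedge, framework, z₁, z₅, ha.ne', hk0.ne']
  · have : wedge (z₃ (framework μ)) (z₂ (framework μ)) = -(a * k) := by
      simp [hμ, wedge, framework, z₂, z₃]; ring
    rw [this]
    have : 0 < a * k := by positivity
    linarith
  · simp [hμ, wedge, framework, z₃, z₄, ha.ne', hk0.ne']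
  · rw [δ₁, n1, n5]
  · rw [h₁, n1, n5]
    simp only [inner_plane]
    simp [hμ, framework, z₁, z₅]
    field_simp

/-- The strict Cauchy–Schwarz condition is open in `c`, so the feedback is identically zero along a
segment in that direction. -/
theorem obsDeriv₁_inner_eq_zero (u : SmoothFn ((ℝ × ℝ) × (ℝ × ℝ × ℝ)))
    (hu : ∀ a b c : ℝ, 0 < a → 0 < b → c ^ 2 < (a * b) ^ 2 → u.1 ((a, b), (a, b, c)) = 0)
    {a b c : ℝ} (ha : 0 < a) (hb : 0 < b) (hc : c ^ 2 < (a * b) ^ 2) :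
    obsDeriv₁ u (a, b) c (0, 0, 1) = 0 := by
  have h1 : HasDerivAt (fun t : ℝ => (((a, b), (a, b, t)) : (ℝ × ℝ) × (ℝ × ℝ × ℝ)))
      ((0, 0), (0, 0, 1)) c :=
    (hasDerivAt_const c (a, b)).prodMk
      ((hasDerivAt_const c a).prodMk ((hasDerivAt_const c b).prodMk (hasDerivAt_id c)))
  have h2 := (u.hasFDerivAt ((a, b), (a, b, c))).comp_hasDerivAt c h1
  have h3 : (u.1 ∘ fun t : ℝ => (((a, b), (a, b, t)) : (ℝ × ℝ) × (ℝ × ℝ × ℝ))) =ᶠ[𝓝 c]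
      fun _ => 0 := by
    have : ∀ᶠ t : ℝ in 𝓝 c, t ^ 2 < (a * b) ^ 2 :=
      (continuous_pow 2).continuousAt.eventually_lt continuousAt_const hc
    filter_upwards [this] with t ht using hu a b t ha hb ht
  exact (h2.congr_of_eventuallyEq h3.symm).unique (hasDerivAt_const c (0 : ℝ))

theorem linDet_neg_of_locallyStabilizes {u : ControlSystem}
    (hE : ∀ μ, IsGeneric (framework μ) → lengthRates u μ = 0) {μ : Target}
    (hμ : IsGeneric (framework μ)) (hs : LocallyStabilizes u μ) : linDet u (framework μ) < 0 := by
  have hz1 := norm_pos_iff.2 (ne_zero_of_wedge_left hμ.1)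
  have hz5 := norm_pos_iff.2 (ne_zero_of_wedge_right hμ.1)
  -- Lagrange's identity: the defect in Cauchy–Schwarz is the square of `wedge z₁ z₅`.
  have hc : (inner ℝ (z₁ (framework μ)) (z₅ (framework μ)) : ℝ) ^ 2 <
      (‖z₁ (framework μ)‖ * ‖z₅ (framework μ)‖) ^ 2 := by
    have := pow_pos (abs_pos.2 hμ.1) 2
    rw [sq_abs] at this
    rw [mul_pow, norm_sq_plane, norm_sq_plane, inner_plane]
    simp only [wedge] at this
    nlinarith
  have hg : ∀ a b c : ℝ, 0 < a → 0 < b → c ^ 2 < (a * b) ^ 2 →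
      u.u₁₁.1 ((a, b), (a, b, c)) = 0 ∧ u.u₁₂.1 ((a, b), (a, b, c)) = 0 := by
    intro a b c ha hb hc
    obtain ⟨ν, hν, hd, hh⟩ := exists_isGeneric ha hb hc
    have h := gains_eq_zero hE hν
    rw [gains, hd, hh] at h
    exact ⟨congrFun h 0, congrFun h 1⟩
  exact linDet_neg_of_isStableAt hμ (gains_eq_zero hE hμ)
    (obsDeriv₁_inner_eq_zero u.u₁₁ (fun a b c ha hb hc => (hg a b c ha hb hc).1) hz1 hz5 hc)
    (obsDeriv₁_inner_eq_zero u.u₁₂ (fun a b c ha hb hc => (hg a b c ha hb hc).2) hz1 hz5 hc) hs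

/-! ### Rotation invariance -/

theorem framework_rotate (θ : ℝ) (μ : Target) :
    framework (fun i => rotate θ (μ i)) = fun i => rotate θ (framework μ i) := by
  ext1 i
  fin_cases i
  · exact (rotate_zero θ).symm
  · rfl
  · rfl
  · rfl

theorem z₁_rotate (θ : ℝ) (x : Config) : z₁ (fun i => rotate θ (x i)) = rotate θ (z₁ x) :=
  (rotate_sub _ _ _).symm

theorem z₂_rotate (θ : ℝ) (x : Config) : z₂ (fun i => rotate θ (x i)) = rotate θ (z₂ x) :=
  (rotate_sub _ _ _).symm

theorem z₃_rotate (θ : ℝ) (x : Config) : z₃ (fun i => rotate θ (x i)) = rotate θ (z₃ x) :=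
  (rotate_sub _ _ _).symm

theorem z₄_rotate (θ : ℝ) (x : Config) : z₄ (fun i => rotate θ (x i)) = rotate θ (z₄ x) :=
  (rotate_sub _ _ _).symm

theorem z₅_rotate (θ : ℝ) (x : Config) : z₅ (fun i => rotate θ (x i)) = rotate θ (z₅ x) :=
  (rotate_sub _ _ _).symm

theorem isGeneric_rotate (θ : ℝ) (μ : Target) :
    IsGeneric (framework fun i => rotate θ (μ i)) ↔ IsGeneric (framework μ) := by
  simp only [IsGeneric, framework_rotate, z₁_rotate, z₂_rotate, z₃_rotate, z₄_rotate, z₅_rotate,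
    wedge_rotate]

theorem linDet_rotate (u : ControlSystem) (θ : ℝ) (μ : Target) :
    linDet u (framework fun i => rotate θ (μ i)) = linDet u (framework μ) := by
  simp only [linDet, framework_rotate, z₁_rotate, z₂_rotate, z₃_rotate, z₄_rotate, z₅_rotate,
    wedge_rotate, norm_rotate, inner_rotate]

theorem lengthRates_rotate (u : ControlSystem) (θ : ℝ) (μ : Target) :
    lengthRates u (fun i => rotate θ (μ i)) = lengthRates u μ := by
  simp only [lengthRates, actuationMatrix, gains, δ₁, δ₂, δ₃, δ₄, h₁, h₂, h₃, h₄, framework_rotate,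
    z₁_rotate, z₂_rotate, z₃_rotate, z₄_rotate, z₅_rotate, norm_rotate, inner_rotate]

/-! ### Continuity in the framework -/

theorem continuous_framework : Continuous framework := by
  refine continuous_pi fun i => ?_
  fin_cases i <;> simp only [framework]
  · exact continuous_const
  · exact continuous_apply 0
  · exact continuous_apply 1
  · exact continuous_apply 2

theorem continuous_z₁ : Continuous z₁ := by unfold z₁; fun_prop

theorem continuous_z₂ : Continuous z₂ := by unfold z₂; fun_prop

theorem continuous_z₃ : Continuous z₃ := by unfold z₃; fun_prop

theorem continuous_z₄ : Continuous z₄ := by unfold z₄; fun_prop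

theorem continuous_z₅ : Continuous z₅ := by unfold z₅; fun_prop

theorem isOpen_isGeneric : IsOpen {μ : Target | IsGeneric (framework μ)} := by
  have h : IsOpen {x : Config | IsGeneric x} :=
    (isOpen_ne_fun (continuous_wedge continuous_z₁ continuous_z₅) continuous_const).inter
      ((isOpen_ne_fun (continuous_wedge continuous_z₃ continuous_z₂) continuous_const).inter
        (isOpen_ne_fun (continuous_wedge continuous_z₃ continuous_z₄) continuous_const))
  exact h.preimage continuous_framework

theorem continuous_obsDeriv (u : SmoothFn (ℝ × ℝ)) : Continuous (obsDeriv u) :=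
  (u.continuous_fderiv_apply _).comp (continuous_id.prodMk continuous_id)

theorem continuous_obsDeriv₁ (u : SmoothFn ((ℝ × ℝ) × (ℝ × ℝ × ℝ))) (v : ℝ × ℝ × ℝ) :
    Continuous fun x : Config =>
      obsDeriv₁ u (‖z₁ x‖, ‖z₅ x‖) (inner ℝ (z₁ x) (z₅ x)) v := by
  have h1 := continuous_z₁
  have h5 := continuous_z₅
  exact (u.continuous_fderiv_apply (0, v)).comp
    (f := fun x : Config => ((‖z₁ x‖, ‖z₅ x‖), ‖z₁ x‖, ‖z₅ x‖, inner ℝ (z₁ x) (z₅ x)))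
    (by fun_prop)

/-- The factor of `linDet` that does not involve agent 1's gains and does not vanish when the
agents 1, 2, 3 become collinear. -/
def linDetFactor (u : ControlSystem) (x : Config) : ℝ :=
  obsDeriv u.u₂ ‖z₂ x‖ * obsDeriv u.u₃ ‖z₃ x‖ * obsDeriv u.u₄ ‖z₄ x‖ *
    (wedge (z₁ x) (z₅ x) * wedge (z₃ x) (z₄ x) *
      (‖z₄ x‖ ^ 2 * wedge (z₃ x) (z₂ x) - ‖z₂ x‖ ^ 2 * wedge (z₃ x) (z₄ x)))

theorem linDet_eq (u : ControlSystem) (x : Config) : linDet u x = linDetFactor u x *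
    gainDet₁ u (‖z₁ x‖, ‖z₅ x‖) (inner ℝ (z₁ x) (z₅ x)) * wedge (z₃ x) (z₂ x) := by
  rw [linDet, linDetFactor]; ring

theorem continuous_linDetFactor (u : ControlSystem) : Continuous (linDetFactor u) := by
  have c2 := (continuous_obsDeriv u.u₂).comp continuous_z₂.norm
  have c3 := (continuous_obsDeriv u.u₃).comp continuous_z₃.norm
  have c4 := (continuous_obsDeriv u.u₄).comp continuous_z₄.norm
  have w15 := continuous_wedge continuous_z₁ continuous_z₅
  have w32 := continuous_wedge continuous_z₃ continuous_z₂
  have w34 := continuous_wedge continuous_z₃ continuous_z₄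
  exact ((c2.mul c3).mul c4).mul ((w15.mul w34).mul
    (((continuous_z₄.norm.pow 2).mul w32).sub ((continuous_z₂.norm.pow 2).mul w34)))

theorem continuous_linDet (u : ControlSystem) : Continuous (linDet u) := by
  have hg : Continuous fun x : Config =>
      gainDet₁ u (‖z₁ x‖, ‖z₅ x‖) (inner ℝ (z₁ x) (z₅ x)) :=
    ((continuous_obsDeriv₁ _ _).mul (continuous_obsDeriv₁ _ _)).sub
      ((continuous_obsDeriv₁ _ _).mul (continuous_obsDeriv₁ _ _))
  rw [funext (linDet_eq u)]
  exact ((continuous_linDetFactor u).mul hg).mul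
    (continuous_wedge continuous_z₃ continuous_z₂)

theorem continuous_lengthRates (u : ControlSystem) : Continuous (lengthRates u) := by
  have h1 := continuous_z₁.comp continuous_framework
  have h2 := continuous_z₂.comp continuous_framework
  have h3 := continuous_z₃.comp continuous_framework
  have h4 := continuous_z₄.comp continuous_framework
  have h5 := continuous_z₅.comp continuous_framework
  simp only [Function.comp_def] at h1 h2 h3 h4 h5
  refine Continuous.matrix_mulVec (continuous_matrix fun i j => ?_) (continuous_pi fun i => ?_)
  · fin_cases i <;> fin_cases j <;> simp [actuationMatrix] <;> fun_prop
  · have c1 : Continuous fun μ => (δ₁ μ, h₁ (framework μ)) := by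
      simp only [δ₁, h₁]; fun_prop
    fin_cases i
    · exact u.u₁₁.2.continuous.comp c1
    · exact u.u₁₂.2.continuous.comp c1
    · exact u.u₂.2.continuous.comp (h2.norm.prodMk h2.norm)
    · exact u.u₃.2.continuous.comp (h3.norm.prodMk h3.norm)
    · exact u.u₄.2.continuous.comp (h4.norm.prodMk h4.norm)

/-! ### Sign change of the determinant and the exceptional set -/

/-- If the position of agent 3 leaves the line through agents 1 and 2, `linDet` changes sign. -/
theorem exists_linDet_pos (u : ControlSystem) (l : ℝ) (μ : Target)
    (hT : linDetFactor u (framework ![μ 0, l • μ 0, μ 2]) ≠ 0)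
    (hψ : gainDet₁ u (δ₁ μ) (h₁ (framework μ)).2.2 ≠ 0) :
    ∃ ν : Target, 0 < linDet u (framework ν) := by
  set T := linDetFactor u (framework ![μ 0, l • μ 0, μ 2]) with hTdef
  set ψ := gainDet₁ u (δ₁ μ) (h₁ (framework μ)).2.2 with hψdef
  -- Agent 3 leaves the line perpendicularly, on the side where `wedge z₃ z₂` has the sign of `T *
  -- ψ` for `η > 0`.
  let γ : ℝ → Target := fun η =>
    ![μ 0, l • μ 0 + (-η * (T * ψ)) • !₂[-μ 0 1, μ 0 0], μ 2]
  have hγ : Continuous γ := by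
    refine continuous_pi fun i => ?_
    fin_cases i <;> simp only [γ]
    · exact continuous_const
    · change Continuous fun η : ℝ => l • μ 0 + (-η * (T * ψ)) • !₂[-μ 0 1, μ 0 0]
      fun_prop
    · exact continuous_const
  have hγ0 : γ 0 = ![μ 0, l • μ 0, μ 2] := by simp [γ]
  have hcont : Continuous fun η => linDetFactor u (framework (γ η)) * T :=
    ((continuous_linDetFactor u).comp (continuous_framework.comp hγ)).mul continuous_const
  have hpos0 : 0 < linDetFactor u (framework (γ 0)) * T := by
    rw [hγ0]; exact mul_self_pos.2 hT
  have hev : ∀ᶠ η in 𝓝[>] (0 : ℝ), 0 < linDetFactor u (framework (γ η)) * T :=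
    (hcont.continuousAt.eventually_const_lt hpos0).filter_mono nhdsWithin_le_nhds
  obtain ⟨η, hη, hη0⟩ := (hev.and self_mem_nhdsWithin).exists
  have hη0 : 0 < η := hη0
  refine ⟨γ η, ?_⟩
  have hw : wedge (z₃ (framework (γ η))) (z₂ (framework (γ η))) =
      η * (T * ψ) * ‖μ 0‖ ^ 2 := by
    rw [norm_sq_plane]
    simp [wedge, z₃, z₂, framework, γ]
    ring
  have hμ0 : 0 < ‖μ 0‖ ^ 2 := by
    have : μ 0 ≠ 0 := by
      intro h0
      apply hT
      rw [hTdef, linDetFactor]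
      simp [z₁, framework, wedge, h0]
    positivity
  -- Definitional, since `z₁` and `z₅` do not involve agent 3.
  have hψη : gainDet₁ u (‖z₁ (framework (γ η))‖, ‖z₅ (framework (γ η))‖)
      (inner ℝ (z₁ (framework (γ η))) (z₅ (framework (γ η)))) = ψ := rfl
  rw [linDet_eq, hw, hψη]
  have : 0 < linDetFactor u (framework (γ η)) * T * (ψ * ψ) * η * ‖μ 0‖ ^ 2 :=
    mul_pos (mul_pos (mul_pos hη (mul_self_pos.2 hψ)) hη0) hμ0
  linarith

theorem isGeneric_of_linDet_ne_zero {u : ControlSystem} {x : Config} (h : linDet u x ≠ 0) :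
    IsGeneric x := by
  rw [linDet] at h
  refine ⟨fun h0 => h ?_, fun h0 => h ?_, fun h0 => h ?_⟩ <;> rw [h0] <;> ring

/-- Agent 3 is displaced from the point `(s, 0)` of the line through agents 1 and 2, so that
projecting it back gives a collinear reference framework. -/
theorem isGeneric_collinear_perturbed {t s r : ℝ} (ht : 0 < t) (hs : 0 < s) (hr : 0 < r) :
    IsGeneric (framework ![!₂[s + t, 0], !₂[s, -(s + t)], !₂[s, r]]) := by
  have hst : s + t ≠ 0 := by positivity
  refine ⟨?_, ?_, ?_⟩ <;> simp [wedge, framework, z₁, z₂, z₃, z₄, z₅]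
  · exact ⟨hst, hr.ne'⟩
  · have h1 : 0 < (s + t) * (s + t) := by positivity
    intro h
    nlinarith
  · exact ⟨hs.ne', fun h => by linarith⟩

/-- Either the product of the derivatives for agents 2, 3, 4 vanishes at all positive lengths, and
`linDet` is zero on all generic frameworks; or `gainDet₁` vanishes wherever the factor at the
collinear position is nonzero, an open condition; or the crossing argument makes `linDet` positive.
-/
theorem exists_isOpen_linDet_nonneg (u : ControlSystem) : ∃ V : Set Target, IsOpen V ∧
    V.Nonempty ∧ V ⊆ {μ | IsGeneric (framework μ) ∧ 0 ≤ linDet u (framework μ)} := by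
  by_cases hκ : ∃ t s r : ℝ, (0 < t ∧ 0 < s ∧ 0 < r) ∧
      obsDeriv u.u₂ t ≠ 0 ∧ obsDeriv u.u₃ s ≠ 0 ∧ obsDeriv u.u₄ r ≠ 0
  · obtain ⟨t, s, r, ⟨ht, hs, hr⟩, k2, k3, k4⟩ := hκ
    have hst : s + t ≠ 0 := by positivity
    set x : Config := framework ![!₂[s + t, 0], !₂[s, 0], !₂[s, r]] with hx
    have hT : linDetFactor u x ≠ 0 := by
      have n2 : ‖z₂ x‖ = t := norm_eq_of_sq_add_sq ht.le (by simp [hx, framework, z₂])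
      have n3 : ‖z₃ x‖ = s := norm_eq_of_sq_add_sq hs.le (by simp [hx, framework, z₃])
      have n4 : ‖z₄ x‖ = r := norm_eq_of_sq_add_sq hr.le (by simp [hx, framework, z₄])
      rw [linDetFactor, n2, n3, n4]
      refine mul_ne_zero (mul_ne_zero (mul_ne_zero k2 k3) k4) ?_
      simp [hx, wedge, framework, z₁, z₂, z₃, z₄, z₅, ht.ne', hs.ne', hr.ne', hst]
    -- `P` puts agent 3 on the line through agents 1 and 2 in a fixed ratio, without changing what
    -- agent 1 observes.
    set P : Target → Target := fun μ => ![μ 0, (s / (s + t)) • μ 0, μ 2] with hP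
    have hPc : Continuous P := by
      refine continuous_pi fun i => ?_
      fin_cases i <;> simp only [hP]
      · exact continuous_apply 0
      · change Continuous fun μ : Target => (s / (s + t)) • μ 0
        fun_prop
      · exact continuous_apply 2
    by_cases hψ : ∃ μ : Target, linDetFactor u (framework (P μ)) ≠ 0 ∧
        gainDet₁ u (δ₁ μ) (h₁ (framework μ)).2.2 ≠ 0
    · obtain ⟨μ, hμT, hμψ⟩ := hψ
      obtain ⟨ν, hν⟩ := exists_linDet_pos u _ μ hμT hμψ
      exact ⟨{ν | 0 < linDet u (framework ν)},
        isOpen_lt continuous_const ((continuous_linDet u).comp continuous_framework), ⟨ν, hν⟩,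
        fun ν hν => ⟨isGeneric_of_linDet_ne_zero hν.ne', hν.le⟩⟩
    · push Not at hψ
      refine ⟨{μ | IsGeneric (framework μ)} ∩ {μ | linDetFactor u (framework (P μ)) ≠ 0},
        isOpen_isGeneric.inter (isOpen_ne_fun ((continuous_linDetFactor u).comp
          (continuous_framework.comp hPc)) continuous_const),
        ⟨![!₂[s + t, 0], !₂[s, -(s + t)], !₂[s, r]],
          isGeneric_collinear_perturbed ht hs hr, ?_⟩, ?_⟩
      · have : P ![!₂[s + t, 0], !₂[s, -(s + t)], !₂[s, r]] =
            ![!₂[s + t, 0], !₂[s, 0], !₂[s, r]] := by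
          ext i j
          fin_cases i <;> fin_cases j <;> simp [hP, hst]
        change linDetFactor u (framework (P _)) ≠ 0
        rw [this]
        exact hT
      · rintro μ ⟨hμ, hμT⟩
        refine ⟨hμ, ?_⟩
        have h0 : gainDet₁ u (‖z₁ (framework μ)‖, ‖z₅ (framework μ)‖)
          (inner ℝ (z₁ (framework μ)) (z₅ (framework μ))) = 0 := hψ μ hμT
        rw [linDet_eq, h0]
        simp
  · refine ⟨{μ | IsGeneric (framework μ)}, isOpen_isGeneric,
      ⟨_, isGeneric_collinear_perturbed one_pos one_pos one_pos⟩, fun μ hμ => ⟨hμ, ?_⟩⟩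
    have hz2 := norm_pos_iff.2 (ne_zero_of_wedge_right hμ.2.1)
    have hz3 := norm_pos_iff.2 (ne_zero_of_wedge_left hμ.2.1)
    have hz4 := norm_pos_iff.2 (ne_zero_of_wedge_right hμ.2.2)
    have h0 : obsDeriv u.u₂ ‖z₂ (framework μ)‖ * obsDeriv u.u₃ ‖z₃ (framework μ)‖ *
        obsDeriv u.u₄ ‖z₄ (framework μ)‖ = 0 := by
      by_contra hne
      rw [mul_eq_zero, mul_eq_zero] at hne
      push Not at hne
      exact hκ ⟨_, _, _, ⟨hz2, hz3, hz4⟩, hne.1.1, hne.1.2, hne.2⟩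
    rw [linDet, h0]
    simp

/-- For every control system, the frameworks that are not locally stabilized contain a measurable
rotation-invariant set of positive measure. -/
theorem exists_not_locallyStabilizes (u : ControlSystem) : ∃ S : Set Target,
    MeasurableSet S ∧ (∀ (θ : ℝ), ∀ μ ∈ S, (fun i => rotate θ (μ i)) ∈ S) ∧
      0 < MeasureTheory.volume S ∧ ∀ μ ∈ S, ¬ LocallyStabilizes u μ := by
  by_cases hE : ∀ μ, IsGeneric (framework μ) → lengthRates u μ = 0
  · obtain ⟨V, hVo, hVne, hVS⟩ := exists_isOpen_linDet_nonneg u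
    -- `V` only supplies positive measure; the larger set defined by `linDet` is the
    -- rotation-invariant one.
    refine ⟨{μ | IsGeneric (framework μ) ∧ 0 ≤ linDet u (framework μ)}, ?_, fun θ μ hμ => ?_,
      (hVo.measure_pos MeasureTheory.volume hVne).trans_le (MeasureTheory.measure_mono hVS),
      fun μ hμ hs => (linDet_neg_of_locallyStabilizes hE hμ.1 hs).not_ge hμ.2⟩
    · exact isOpen_isGeneric.measurableSet.inter (isClosed_le continuous_const
        ((continuous_linDet u).comp continuous_framework)).measurableSet
    · exact ⟨(isGeneric_rotate θ μ).2 hμ.1, (linDet_rotate u θ μ).symm ▸ hμ.2⟩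
  · push Not at hE
    obtain ⟨ν, hν, hν0⟩ := hE
    have hopen : IsOpen {μ | IsGeneric (framework μ) ∧ lengthRates u μ ≠ 0} :=
      isOpen_isGeneric.inter (isOpen_ne_fun (continuous_lengthRates u) continuous_const)
    exact ⟨{μ | IsGeneric (framework μ) ∧ lengthRates u μ ≠ 0}, hopen.measurableSet,
      fun θ μ hμ => ⟨(isGeneric_rotate θ μ).2 hμ.1, (lengthRates_rotate u θ μ).symm ▸ hμ.2⟩,
      hopen.measure_pos MeasureTheory.volume ⟨ν, hν, hν0⟩,
      fun μ hμ hs => hμ.2 (lengthRates_eq_zero_of_locallyStabilizes hs)⟩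

theorem exists_target_not_locallyStabilizes (u : ControlSystem) :
    ∃ μ : Target, ¬ LocallyStabilizes u μ := by
  obtain ⟨S, -, -, hpos, hS⟩ := exists_not_locallyStabilizes u
  obtain ⟨μ, hμ⟩ := MeasureTheory.nonempty_of_measure_ne_zero hpos.ne'
  exact ⟨μ, hS μ hμ⟩

end TwoCycles

end

/-- Both robustness claims already fail for the unperturbed `u`, which belongs to each of its
neighbourhoods. -/
theorem mainTheorem2 (r : ℕ∞) :
    (¬ ∃ u : TwoCycles.ControlSystem, TwoCycles.Robustly r TwoCycles.StabilizesAll u) ∧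
    (¬ ∃ u : TwoCycles.ControlSystem, TwoCycles.RobustlyStabilizesAll r u) ∧
    ∀ u : TwoCycles.ControlSystem, ∃ S : Set TwoCycles.Target,
      MeasurableSet S ∧
      (∀ (θ : ℝ), ∀ μ ∈ S, (fun i => TwoCycles.rotate θ (μ i)) ∈ S) ∧
      0 < MeasureTheory.volume S ∧
      ∀ μ ∈ S, ¬ TwoCycles.LocallyStabilizes u μ := by
  refine ⟨?_, ?_, TwoCycles.exists_not_locallyStabilizes⟩
  · rintro ⟨u, N, -, huN, hN⟩
    obtain ⟨μ, hμ⟩ := TwoCycles.exists_target_not_locallyStabilizes u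
    exact hμ (hN u huN μ)
  · rintro ⟨u, hu⟩
    obtain ⟨μ, hμ⟩ := TwoCycles.exists_target_not_locallyStabilizes u
    exact hμ (hu μ).1
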